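/- Let $\epsilon > 0$. For each $n \geq 1$ let $z = z^{(n)} \in \{\pm 1\}^n$ be deterministic, let $W = W^{(n)}$ be a random symmetric $n \times n$ real matrix whose entries $W_{ij}$, $i < j$, are independent standard normal random variables (the diagonal entries are arbitrary), and let $$C = z z^T + \sigma W,$$ where the noise level $\sigma = \sigma_n \geq 0$ may depend on $n$ and satisfies, for all sufficiently large $n$, $$\sigma \leq \sqrt{\frac{n}{(2+\epsilon) \log n}}.$$ For an integer $r \geq 2$ consider the problem $$\max_{Y \in \mathbf{R}^{n \times r}} \ \langle C, Y Y^T \rangle = \sum_{i,j=1}^n C_{ij} \langle y_i, y_j \rangle \quad \text{subject to} \quad \operatorname{diag}(Y Y^T) = \mathbf{1},$$ where $y_1, \dots, y_n \in \mathbf{R}^r$ are the rows of $Y$, so that the constraint set is the product of unit spheres $(S^{r-1})^n$, a Riemannian submanifold of $\mathbf{R}^{n \times r}$. A feasible $Y$ is called a second-order critical point if the Riemannian gradient of the objective function vanishes at $Y$ and its Riemannian Hessian at $Y$ is negative semidefinite. Then, with probability tending to $1$ as $n \to \infty$, the following holds simultaneously for all $r \geq 2$: every second-order critical point $Y$ of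 this problem satisfies $Y Y^T = z z^T$. -/

import Mathlib

/-- The space `ℝ^{n × r}` of `n`-tuples `Y = (y_1, …, y_n)` of vectors of `ℝ^r` (the rows of the
matrix `Y`), with the Euclidean (Frobenius) inner product. -/
abbrev Config (n r : ℕ) : Type :=
  PiLp 2 (fun _ : Fin n => EuclideanSpace ℝ (Fin r))

namespace Config

variable {n r : ℕ}

/-- `Y` viewed as an `n × r` matrix whose rows are `y_1, …, y_n`. -/
def toMatrix (Y : Config n r) : Matrix (Fin n) (Fin r) ℝ :=
  Matrix.of fun i k => Y i k

/-- Membership in the product of spheres `(S^{r-1})^n`, the constraint set `diag(Y Yᵀ) = 1`. -/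
def OnSpheres (Y : Config n r) : Prop :=
  ∀ i, ‖Y i‖ = 1

/-- Membership of `U` in the tangent space to the product of spheres at `Y`. -/
def IsTangent (Y U : Config n r) : Prop :=
  ∀ i, inner ℝ (Y i) (U i) = 0

/-- For `Y` on the product of spheres, the orthogonal projection of `U` onto the tangent space
at `Y`; the formula extends it smoothly to all `Y`. -/
noncomputable def tangentProj (Y U : Config n r) : Config n r :=
  WithLp.toLp 2 fun i => U i - inner ℝ (Y i) (U i) • Y i

/-- The Riemannian gradient of (the restriction to the product of spheres of) `f`: the tangential
part of the Euclidean gradient. -/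
noncomputable def riemGradient (f : Config n r → ℝ) (Y : Config n r) : Config n r :=
  tangentProj Y (gradient f Y)

/-- The Riemannian Hessian of (the restriction to the product of spheres of) `f` at `Y`, applied to
a tangent vector `U`: the covariant derivative of the Riemannian gradient in the direction `U`,
which for a submanifold of a Euclidean space is the tangential part of the Euclidean derivative. -/
noncomputable def riemHessian (f : Config n r → ℝ) (Y U : Config n r) : Config n r :=
  tangentProj Y (fderiv ℝ (riemGradient f) Y U)

/-- `Y` is a second-order critical point of the problem of maximizing `f` over the product of
spheres: `Y` is feasible, the Riemannian gradient vanishes at `Y`, and the Riemannian Hessian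
at `Y` is negative semidefinite on the tangent space. -/
structure IsSecondOrderCritical (f : Config n r → ℝ) (Y : Config n r) : Prop where
  onSpheres : OnSpheres Y
  gradient_eq_zero : riemGradient f Y = 0
  hessian_nonpos : ∀ U : Config n r, IsTangent Y U → inner ℝ U (riemHessian f Y U) ≤ 0

end Config

/-- The objective function `∑_{i,j} C_{ij} ⟨y_i, y_j⟩ = ⟨C, Y Yᵀ⟩`. -/
noncomputable def syncObjective {n : ℕ} (C : Matrix (Fin n) (Fin n) ℝ) (r : ℕ)
    (Y : Config n r) : ℝ :=
  ∑ i, ∑ j, C i j * inner ℝ (Y i) (Y j)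

/-- `W` is a random symmetric matrix whose entries above the diagonal are independent standard
normal random variables. Nothing is required of the diagonal. -/
structure IsGaussianNoise {Ω : Type*} [MeasurableSpace Ω] (P : MeasureTheory.Measure Ω) {n : ℕ}
    (W : Ω → Matrix (Fin n) (Fin n) ℝ) : Prop where
  symm : ∀ ω, (W ω).IsSymm
  law : ∀ i j : Fin n, i < j →
    ProbabilityTheory.HasLaw (fun ω => W ω i j) (ProbabilityTheory.gaussianReal 0 1) P
  indep : ProbabilityTheory.iIndepFun
    (fun (p : {p : Fin n × Fin n // p.1 < p.2}) ω => W ω p.1.1 p.1.2) P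

/-! Flipping signs by `z` and moving the diagonal into the multipliers reduces the problem to the
all-ones matrix plus a symmetric `A` with zero diagonal, where all rows `y_i` must be shown equal.
Only two facts about `A` matter: its operator norm is at most `η n` with `η` small, and its row sums
are at least `-t n` with `t < 1`.

Averaging the Hessian condition over projected coordinate directions forces `s = ∑ y_i` to be long
(`sq_norm_sum_ge_of_second_order`); testing it at a single site makes the multipliers `l_i`
nonnegative. With `h` the direction of `s`, the first-order condition then gives `B = ∑ (1 - ⟨y_i,
h⟩) = O(η² n)`. Pairing that condition with `y_i` and `h` evaluates `∑ l_i (1 - ⟨y_i, h⟩)²` exactly.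
This sum is nonnegative, yet at most `2B(-‖s‖ + t n + 2 η n)` with a negative bracket, so `B = 0`
(`inner_eq_one_of_second_order`).

For the noise (`IsGaussianNoise.measureReal_compl_good_le`), a net bounds the operator norm by `16
√n`, which is negligible after scaling by `σ`; the constant `2 + ε` is spent on a union bound over
the `n` row sums. The good event involves neither `r` nor `Y`, whence the uniformity in `r`. -/

/-! ### Deterministic landscape analysis -/

section Deterministic

variable {ι : Type*} [Fintype ι] {r : ℕ}

/-- A matrix of operator norm at most `κ` has quadratic form at most `κ ‖x‖²`. -/
lemma abs_quadForm_le {A : Matrix ι ι ℝ} {κ : ℝ} (hκ : 0 ≤ κ)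
    (hA : ∀ x : ι → ℝ, ∑ i, (∑ j, A i j * x j) ^ 2 ≤ κ ^ 2 * ∑ i, x i ^ 2) (x : ι → ℝ) :
    |∑ i, ∑ j, A i j * (x i * x j)| ≤ κ * ∑ i, x i ^ 2 := by
  have hS : 0 ≤ ∑ i, x i ^ 2 := Finset.sum_nonneg fun i _ => sq_nonneg _
  have h1 : ∑ i, ∑ j, A i j * (x i * x j) = ∑ i, x i * ∑ j, A i j * x j := by
    refine Finset.sum_congr rfl fun i _ => ?_
    rw [Finset.mul_sum]
    exact Finset.sum_congr rfl fun j _ => by ring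
  rw [h1]
  refine abs_le_of_sq_le_sq ?_ (mul_nonneg hκ hS)
  calc (∑ i, x i * ∑ j, A i j * x j) ^ 2
      ≤ (∑ i, x i ^ 2) * ∑ i, (∑ j, A i j * x j) ^ 2 := Finset.sum_mul_sq_le_sq_mul_sq _ _ _
    _ ≤ (∑ i, x i ^ 2) * (κ ^ 2 * ∑ i, x i ^ 2) := mul_le_mul_of_nonneg_left (hA x) hS
    _ = (κ * ∑ i, x i ^ 2) ^ 2 := by ring

/-- Coordinate by coordinate this is the scalar bound. The index type is free so that it also
applies to the vectors `tensorSq (y i)`. -/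
lemma abs_quadForm_inner_le {A : Matrix ι ι ℝ} {κ : ℝ} (hκ : 0 ≤ κ)
    (hA : ∀ x : ι → ℝ, ∑ i, (∑ j, A i j * x j) ^ 2 ≤ κ ^ 2 * ∑ i, x i ^ 2)
    {τ : Type*} [Fintype τ] (u : ι → EuclideanSpace ℝ τ) :
    |∑ i, ∑ j, A i j * inner ℝ (u i) (u j)| ≤ κ * ∑ i, ‖u i‖ ^ 2 := by
  have h1 : ∑ i, ∑ j, A i j * inner ℝ (u i) (u j) =
      ∑ k, ∑ i, ∑ j, A i j * (u i k * u j k) := by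
    symm
    rw [Finset.sum_comm]
    refine Finset.sum_congr rfl fun i _ => ?_
    rw [Finset.sum_comm]
    refine Finset.sum_congr rfl fun j _ => ?_
    rw [PiLp.inner_apply, Finset.mul_sum]
    refine Finset.sum_congr rfl fun k _ => ?_
    simp [mul_comm]
  have h2 : ∑ i, ‖u i‖ ^ 2 = ∑ k, ∑ i, u i k ^ 2 := by
    rw [Finset.sum_comm]
    exact Finset.sum_congr rfl fun i _ => EuclideanSpace.real_norm_sq_eq _
  rw [h1, h2, Finset.mul_sum]
  exact (Finset.abs_sum_le_sum_abs _ _).trans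
    (Finset.sum_le_sum fun k _ => abs_quadForm_le hκ hA fun i => u i k)

lemma sum_norm_sum_smul_sq_le {A : Matrix ι ι ℝ} {κ : ℝ}
    (hA : ∀ x : ι → ℝ, ∑ i, (∑ j, A i j * x j) ^ 2 ≤ κ ^ 2 * ∑ i, x i ^ 2)
    (u : ι → EuclideanSpace ℝ (Fin r)) :
    ∑ i, ‖∑ j, A i j • u j‖ ^ 2 ≤ κ ^ 2 * ∑ i, ‖u i‖ ^ 2 := by
  simp only [EuclideanSpace.real_norm_sq_eq]
  rw [Finset.sum_comm, Finset.sum_comm (f := fun i k => u i k ^ 2), Finset.mul_sum]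
  refine Finset.sum_le_sum fun k _ => ?_
  simpa using hA fun i => u i k

/-- The rank-one matrix `y yᵀ`, as a vector. -/
noncomputable def tensorSq (y : EuclideanSpace ℝ (Fin r)) : EuclideanSpace ℝ (Fin r × Fin r) :=
  WithLp.toLp 2 fun k => y k.1 * y k.2

/-- Shows that the entrywise square of a Gram matrix is again a Gram matrix, so the operator norm of
`A` controls its pairing with that square too. -/
lemma inner_tensorSq (x y : EuclideanSpace ℝ (Fin r)) :
    inner ℝ (tensorSq x) (tensorSq y) = inner ℝ x y ^ 2 := by
  simp only [PiLp.inner_apply, tensorSq, Fintype.sum_prod_type, sq, Finset.sum_mul_sum]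
  refine Finset.sum_congr rfl fun k _ => Finset.sum_congr rfl fun l _ => ?_
  simp
  ring

/-- The Gram matrix of unit vectors of `ℝ^r` has squared Frobenius norm at least `n² / r`. -/
lemma card_sq_le_mul_sum_inner_sq {y : ι → EuclideanSpace ℝ (Fin r)} (hy : ∀ i, ‖y i‖ = 1) :
    (Fintype.card ι : ℝ) ^ 2 ≤ r * ∑ i, ∑ j, inner ℝ (y i) (y j) ^ 2 := by
  -- `Y Yᵀ` and `Yᵀ Y` have the same Frobenius norm. The latter is `r × r` of trace `n`: keep its
  -- diagonal and apply Cauchy-Schwarz.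
  have h1 : ∑ i, ∑ j, inner ℝ (y i) (y j) ^ 2 =
      ∑ k : Fin r × Fin r, (∑ i, y i k.1 * y i k.2) ^ 2 := by
    have : ∑ i, ∑ j, inner ℝ (y i) (y j) ^ 2 = ‖∑ i, tensorSq (y i)‖ ^ 2 := by
      rw [← real_inner_self_eq_norm_sq, sum_inner]
      simp only [inner_sum, inner_tensorSq]
    rw [this, EuclideanSpace.real_norm_sq_eq]
    simp [tensorSq]
  have h2 : (Fintype.card ι : ℝ) = ∑ k : Fin r, ∑ i, y i k * y i k := by
    rw [Finset.sum_comm]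
    have : ∀ i, ∑ k, y i k * y i k = 1 := fun i => by
      have := EuclideanSpace.real_norm_sq_eq (y i)
      rw [hy] at this
      simp only [← sq]
      linarith
    simp [this]
  have h3 : ∑ k : Fin r, (∑ i, y i k * y i k) ^ 2 ≤
      ∑ k : Fin r × Fin r, (∑ i, y i k.1 * y i k.2) ^ 2 := by
    rw [Fintype.sum_prod_type]
    refine Finset.sum_le_sum fun k _ => ?_
    exact Finset.single_le_sum (f := fun l => (∑ i, y i k * y i l) ^ 2)
      (fun l _ => sq_nonneg _) (Finset.mem_univ k)
  rw [h1, h2]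
  refine le_trans ?_ (mul_le_mul_of_nonneg_left h3 (Nat.cast_nonneg r))
  simpa using sq_sum_le_card_mul_sum_sq (s := Finset.univ)
    (f := fun k : Fin r => ∑ i, y i k * y i k)

/-- Summing the second-order condition over the tangent directions `e_k - ⟨y_i, e_k⟩ y_i`. -/
lemma sum_mul_inner_sq_le_of_second_order {C : Matrix ι ι ℝ} {y : ι → EuclideanSpace ℝ (Fin r)}
    {l : ι → ℝ} (hy : ∀ i, ‖y i‖ = 1)
    (hH : ∀ u : ι → EuclideanSpace ℝ (Fin r), (∀ i, inner ℝ (y i) (u i) = 0) →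
      ∑ i, ∑ j, C i j * inner ℝ (u i) (u j) ≤ ∑ i, l i * ‖u i‖ ^ 2) :
    ∑ i, ∑ j, C i j * (r - 2 + inner ℝ (y i) (y j) ^ 2) ≤ (r - 1) * ∑ i, l i := by
  let e : Fin r → EuclideanSpace ℝ (Fin r) := fun k => EuclideanSpace.single k 1
  let u : Fin r → ι → EuclideanSpace ℝ (Fin r) := fun k i => e k - y i k • y i
  have hyy : ∀ i, inner ℝ (y i) (y i) = 1 := fun i => by
    rw [real_inner_self_eq_norm_sq, hy, one_pow]
  have hye : ∀ i k, inner ℝ (y i) (e k) = y i k := fun i k => by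
    simp [e, EuclideanSpace.inner_single_right]
  have hey : ∀ i k, inner ℝ (e k) (y i) = y i k := fun i k => by rw [real_inner_comm, hye]
  have hee : ∀ k, inner ℝ (e k) (e k) = 1 := fun k => by simp [e]
  have hT : ∀ k i, inner ℝ (y i) (u k i) = 0 := fun k i => by
    simp only [u, inner_sub_right, real_inner_smul_right, hye, hyy]; ring
  have hu : ∀ k i j, inner ℝ (u k i) (u k j) =
      1 - y i k * y i k - y j k * y j k + y i k * y j k * inner ℝ (y i) (y j) := fun k i j => by
    simp only [u, inner_sub_right, inner_sub_left, real_inner_smul_right, real_inner_smul_left,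
      hye, hey, hee]
    ring
  have hsum : ∀ i j, ∑ k, y i k * y j k = inner ℝ (y i) (y j) := fun i j => by
    rw [PiLp.inner_apply]
    exact Finset.sum_congr rfl fun k _ => by simp [mul_comm]
  -- This is the trace of the product of the projections `I - y_i y_iᵀ` and `I - y_j y_jᵀ`.
  have hsu : ∀ i j, ∑ k, inner ℝ (u k i) (u k j) = r - 2 + inner ℝ (y i) (y j) ^ 2 := fun i j => by
    simp only [hu, Finset.sum_add_distrib, Finset.sum_sub_distrib, ← Finset.sum_mul, hsum, hyy]
    simp
    ring
  have key : ∑ k, ∑ i, ∑ j, C i j * inner ℝ (u k i) (u k j) ≤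
      ∑ k, ∑ i, l i * ‖u k i‖ ^ 2 := Finset.sum_le_sum fun k _ => hH (u k) (hT k)
  have hL : ∑ k, ∑ i, ∑ j, C i j * inner ℝ (u k i) (u k j) =
      ∑ i, ∑ j, C i j * (r - 2 + inner ℝ (y i) (y j) ^ 2) := by
    rw [Finset.sum_comm]
    refine Finset.sum_congr rfl fun i _ => ?_
    rw [Finset.sum_comm]
    refine Finset.sum_congr rfl fun j _ => ?_
    rw [← Finset.mul_sum, hsu]
  have hR : ∑ k, ∑ i, l i * ‖u k i‖ ^ 2 = (r - 1) * ∑ i, l i := by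
    rw [Finset.sum_comm, Finset.mul_sum]
    refine Finset.sum_congr rfl fun i _ => ?_
    rw [← Finset.mul_sum]
    simp only [← real_inner_self_eq_norm_sq]
    rw [hsu, hyy]
    ring
  rwa [hL, hR] at key

/-- The multipliers of a second-order critical point dominate the diagonal. -/
lemma diag_le_of_second_order {C : Matrix ι ι ℝ} {y : ι → EuclideanSpace ℝ (Fin r)}
    {l : ι → ℝ} (hr : 2 ≤ r)
    (hH : ∀ u : ι → EuclideanSpace ℝ (Fin r), (∀ i, inner ℝ (y i) (u i) = 0) →
      ∑ i, ∑ j, C i j * inner ℝ (u i) (u j) ≤ ∑ i, l i * ‖u i‖ ^ 2) (i : ι) :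
    C i i ≤ l i := by
  classical
  -- `r ≥ 2` leaves room for a unit vector orthogonal to `y i`; the test direction is supported at
  -- site `i` alone.
  obtain ⟨v, hv, hv1⟩ : ∃ v : EuclideanSpace ℝ (Fin r), inner ℝ (y i) v = 0 ∧ ‖v‖ = 1 := by
    have : 0 < Module.finrank ℝ ((ℝ ∙ y i)ᗮ : Submodule ℝ (EuclideanSpace ℝ (Fin r))) := by
      have h1 := Submodule.finrank_add_finrank_orthogonal (ℝ ∙ y i)
      have h2 := (finrank_span_le_card (R := ℝ) {y i}).trans_eq (Set.toFinset_card _)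
      rw [finrank_euclideanSpace_fin] at h1
      simp only [Fintype.card_unique] at h2
      omega
    have := Module.nontrivial_of_finrank_pos this
    obtain ⟨w, hw⟩ := exists_norm_eq ((ℝ ∙ y i)ᗮ : Submodule ℝ (EuclideanSpace ℝ (Fin r)))
      zero_le_one
    exact ⟨w, Submodule.mem_orthogonal_singleton_iff_inner_right.1 w.2, by simpa using hw⟩
  have h := hH (Pi.single i v) fun j => by
    by_cases hj : j = i
    · subst hj; simpa using hv
    · simp [hj]
  have h1 : ∑ k, ∑ j, C k j * inner ℝ ((Pi.single i v : ι → EuclideanSpace ℝ (Fin r)) k)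
      ((Pi.single i v : ι → EuclideanSpace ℝ (Fin r)) j) = C i i := by
    rw [Fintype.sum_eq_single i fun k hk => by simp [hk],
      Fintype.sum_eq_single i fun k hk => by simp [hk]]
    simp [hv1]
  have h2 : ∑ k, l k * ‖(Pi.single i v : ι → EuclideanSpace ℝ (Fin r)) k‖ ^ 2 = l i := by
    rw [Fintype.sum_eq_single i fun k hk => by simp [hk]]
    simp [hv1]
  rwa [h1, h2] at h

/-- If `α u - β v` is small compared with `β`, for unit vectors `u`, `v`, then `u` is close
to `v`. -/
lemma one_sub_inner_mul_sq_le {E : Type*} [NormedAddCommGroup E] [InnerProductSpace ℝ E] {u v : E}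
    (hu : ‖u‖ = 1) (hv : ‖v‖ = 1) {a b : ℝ} (ha : 0 ≤ a) (hb : 0 ≤ b) :
    (1 - inner ℝ u v) * b ^ 2 ≤ 2 * ‖a • u - b • v‖ ^ 2 := by
  have h1 : ‖a • u - b • v‖ ^ 2 = a ^ 2 + b ^ 2 - 2 * (a * b * inner ℝ u v) := by
    rw [norm_sub_sq_real, norm_smul, norm_smul, hu, hv, real_inner_smul_left, real_inner_smul_right]
    simp
    ring
  have hc := abs_le.1 (abs_real_inner_le_norm u v)
  rw [hu, hv] at hc
  rw [h1]
  generalize inner ℝ u v = c at *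
  -- For `c ≥ 0`, minimizing over `a` leaves `b² (1 - c²) ≥ b² (1 - c)`. For `c ≤ 0` the squared
  -- norm is at least `b²` while `1 - c ≤ 2`, which accounts for the factor 2.
  rcases le_total 0 c with h | h
  · nlinarith [sq_nonneg (a - b * c),
      mul_nonneg (mul_nonneg h (by linarith : 0 ≤ 1 - c)) (sq_nonneg b),
      mul_nonneg (by linarith : 0 ≤ 1 - c) (sq_nonneg b)]
  · nlinarith [mul_nonneg (mul_nonneg ha hb) (neg_nonneg.2 h), sq_nonneg a, sq_nonneg b,
      mul_nonneg (by linarith : 0 ≤ 1 + c) (sq_nonneg b)]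

/-- At a second-order critical point, the sum of the `y_i` is large. -/
lemma sq_norm_sum_ge_of_second_order {A : Matrix ι ι ℝ} {y : ι → EuclideanSpace ℝ (Fin r)}
    {l : ι → ℝ} {κ : ℝ} (hr : 2 ≤ r) (hy : ∀ i, ‖y i‖ = 1)
    (hF : ∀ i, ∑ j, y j + ∑ j, A i j • y j = l i • y i)
    (hH : ∀ u : ι → EuclideanSpace ℝ (Fin r), (∀ i, inner ℝ (y i) (u i) = 0) →
      ∑ i, ∑ j, (1 + A i j) * inner ℝ (u i) (u j) ≤ ∑ i, l i * ‖u i‖ ^ 2)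
    (hκ : 0 ≤ κ)
    (hA : ∀ x : ι → ℝ, ∑ i, (∑ j, A i j * x j) ^ 2 ≤ κ ^ 2 * ∑ i, x i ^ 2) :
    (Fintype.card ι : ℝ) ^ 2 / 2 - 2 * κ * Fintype.card ι ≤ ‖∑ i, y i‖ ^ 2 := by
  set n : ℝ := (Fintype.card ι : ℝ) with hn
  have hn0 : 0 ≤ n := Nat.cast_nonneg _
  have hr' : (2 : ℝ) ≤ r := by exact_mod_cast hr
  have hl : ∑ i, l i = ‖∑ i, y i‖ ^ 2 + ∑ i, ∑ j, A i j * inner ℝ (y i) (y j) := by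
    rw [← real_inner_self_eq_norm_sq, sum_inner, ← Finset.sum_add_distrib]
    refine Finset.sum_congr rfl fun i _ => ?_
    have := congrArg (inner ℝ (y i)) (hF i)
    simp only [inner_add_right, inner_sum (𝕜 := ℝ) (f := fun j => A i j • y j),
      real_inner_smul_right, real_inner_self_eq_norm_sq, hy] at this
    linarith
  have h0 := sum_mul_inner_sq_le_of_second_order (C := Matrix.of fun i j => 1 + A i j) hy hH
  have h1 : ∑ i, ∑ j, (1 + A i j) * (r - 2 + inner ℝ (y i) (y j) ^ 2) =
      (r - 2) * (n ^ 2 + ∑ i, ∑ j, A i j) + ∑ i, ∑ j, inner ℝ (y i) (y j) ^ 2 +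
        ∑ i, ∑ j, A i j * inner ℝ (y i) (y j) ^ 2 := by
    have : n ^ 2 = ∑ _i : ι, ∑ _j : ι, (1 : ℝ) := by simp [hn, sq]
    rw [this]
    simp only [mul_add, Finset.mul_sum, ← Finset.sum_add_distrib]
    refine Finset.sum_congr rfl fun i _ => Finset.sum_congr rfl fun j _ => ?_
    ring
  simp only [Matrix.of_apply] at h0
  rw [h1, hl] at h0
  have h2 := card_sq_le_mul_sum_inner_sq hy
  have h3 := (abs_le.1 (abs_quadForm_inner_le hκ hA y)).2
  have h4 := (abs_le.1 (abs_quadForm_inner_le hκ hA fun i => tensorSq (y i))).1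
  have h5 := (abs_le.1 (abs_quadForm_le hκ hA fun _ => 1)).1
  have h6 : ∀ i, ‖tensorSq (y i)‖ ^ 2 = 1 := fun i => by
    rw [← real_inner_self_eq_norm_sq, inner_tensorSq, real_inner_self_eq_norm_sq, hy]; norm_num
  simp only [inner_tensorSq, h6] at h4
  simp only [hy, one_pow, mul_one, Finset.sum_const, Finset.card_univ, nsmul_eq_mul, ← hn]
    at h3 h4 h5
  rw [← hn] at h2
  set R := ∑ i, ∑ j, inner ℝ (y i) (y j) ^ 2
  set m2 := ‖∑ i, y i‖ ^ 2
  have h7 : n ^ 2 / r ≤ R := by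
    rw [div_le_iff₀ (by linarith)]; linarith
  -- Equality holds at `r = 2`, the worst case; this fixes the constant `1 / 2` of the conclusion.
  have h8 : (r - 1) * (n ^ 2 / 2) ≤ (r - 2) * n ^ 2 + n ^ 2 / r := by
    have : (r - 2) * n ^ 2 + n ^ 2 / r - (r - 1) * (n ^ 2 / 2) =
        (r - 1) * (r - 2) / (2 * r) * n ^ 2 := by
      field_simp
      ring
    have h9 : 0 ≤ ((r : ℝ) - 1) * (r - 2) / (2 * r) * n ^ 2 :=
      mul_nonneg (div_nonneg (mul_nonneg (by linarith) (by linarith)) (by linarith)) (sq_nonneg _)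
    linarith
  have h9 := mul_le_mul_of_nonneg_left h3 (by linarith : (0 : ℝ) ≤ r - 1)
  have h10 := mul_le_mul_of_nonneg_left h5 (by linarith : (0 : ℝ) ≤ r - 2)
  refine le_of_mul_le_mul_left ?_ (by linarith : (0 : ℝ) < r - 1)
  nlinarith

/-- Second-order critical points of a well-conditioned perturbation of the noiseless problem have
all their rows equal. -/
theorem inner_eq_one_of_second_order [Nonempty ι] {A : Matrix ι ι ℝ}
    {y : ι → EuclideanSpace ℝ (Fin r)} {l : ι → ℝ} {η t : ℝ} (hr : 2 ≤ r)
    (hA_symm : A.IsSymm) (hA_diag : ∀ i, A i i = 0) (hy : ∀ i, ‖y i‖ = 1)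
    (hF : ∀ i, ∑ j, y j + ∑ j, A i j • y j = l i • y i)
    (hH : ∀ u : ι → EuclideanSpace ℝ (Fin r), (∀ i, inner ℝ (y i) (u i) = 0) →
      ∑ i, ∑ j, (1 + A i j) * inner ℝ (u i) (u j) ≤ ∑ i, l i * ‖u i‖ ^ 2)
    (hη : 0 ≤ η) (hη8 : η ≤ 1 / 8) (hηt : 8 * η ^ 2 + 2 * η < 1 - t)
    (hA : ∀ x : ι → ℝ, ∑ i, (∑ j, A i j * x j) ^ 2 ≤
      (η * Fintype.card ι) ^ 2 * ∑ i, x i ^ 2)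
    (hrow : ∀ i, -(t * Fintype.card ι) ≤ ∑ j, A i j) (i j : ι) :
    inner ℝ (y i) (y j) = 1 := by
  have hs := sq_norm_sum_ge_of_second_order hr hy hF hH (mul_nonneg hη (Nat.cast_nonneg _)) hA
  have hl : ∀ i, 0 ≤ l i := fun i => by
    have := diag_le_of_second_order (C := Matrix.of fun i j => 1 + A i j) hr hH i
    simp only [Matrix.of_apply, hA_diag] at this
    linarith
  set n : ℝ := (Fintype.card ι : ℝ) with hn
  have hn0 : 0 < n := by rw [hn]; exact_mod_cast Fintype.card_pos
  set s := ∑ i, y i with hs_def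
  set m := ‖s‖ with hm
  have hm4 : n ^ 2 / 4 ≤ m ^ 2 := by nlinarith [mul_nonneg (sub_nonneg.2 hη8) (sq_nonneg n)]
  have hm0 : 0 < m := by
    refine lt_of_le_of_ne (norm_nonneg _) fun h => ?_
    rw [← h] at hm4
    nlinarith
  obtain ⟨h, hh, hsh⟩ : ∃ h : EuclideanSpace ℝ (Fin r), ‖h‖ = 1 ∧ s = m • h := by
    refine ⟨m⁻¹ • s, ?_, ?_⟩
    · rw [norm_smul, norm_inv, Real.norm_of_nonneg hm0.le]; exact inv_mul_cancel₀ hm0.ne'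
    · rw [smul_smul, mul_inv_cancel₀ hm0.ne', one_smul]
  set a : ι → ℝ := fun i => inner ℝ (y i) h with ha
  have ha1 : ∀ i, a i ≤ 1 ∧ -1 ≤ a i := fun i => by
    have := abs_le.1 (abs_real_inner_le_norm (y i) h)
    rw [hy, hh] at this
    exact ⟨by linarith [this.2], by linarith [this.1]⟩
  have hsa : ∑ i, a i = m := by
    rw [ha, ← sum_inner, ← hs_def, hsh, real_inner_smul_left, real_inner_self_eq_norm_sq, hh]
    simp
  set B := ∑ i, (1 - a i) with hB
  have hBm : B = n - m := by rw [hB, Finset.sum_sub_distrib, hsa]; simp [hn]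
  have hB0 : 0 ≤ B := Finset.sum_nonneg fun i _ => by linarith [(ha1 i).1]
  -- a first, rough bound on `B`
  have hBsmall : B ≤ 8 * η ^ 2 * n := by
    -- The first-order condition reads `l_i y_i - m h = ∑ j, A i j • y j`, with both coefficients
    -- nonnegative.
    have h1 : ∀ i, (1 - a i) * m ^ 2 ≤ 2 * ‖∑ j, A i j • y j‖ ^ 2 := fun i => by
      have := one_sub_inner_mul_sq_le (hy i) hh (hl i) hm0.le
      rwa [← hF i, ← hsh, add_sub_cancel_left] at this
    have h2 := Finset.sum_le_sum fun i (_ : i ∈ Finset.univ) => h1 i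
    rw [← Finset.sum_mul, ← Finset.mul_sum] at h2
    have h3 := sum_norm_sum_smul_sq_le hA y
    simp only [hy, one_pow, Finset.sum_const, Finset.card_univ, nsmul_eq_mul, mul_one, ← hn] at h3
    have h4 : B * (n ^ 2 / 4) ≤ 2 * ((η * n) ^ 2 * n) :=
      (mul_le_mul_of_nonneg_left hm4 hB0).trans (h2.trans (by linarith))
    have : B * (n ^ 2 / 4) ≤ 8 * η ^ 2 * n * (n ^ 2 / 4) := h4.trans_eq (by ring)
    exact le_of_mul_le_mul_right this (by positivity)
  have hFa : ∀ i, l i * a i = m + ∑ j, A i j * a j := fun i => by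
    have := congrArg (fun v => inner ℝ v h) (hF i)
    simp only [inner_add_left, sum_inner (𝕜 := ℝ) (f := fun j => A i j • y j),
      real_inner_smul_left] at this
    rw [hsh, real_inner_smul_left, real_inner_self_eq_norm_sq, hh] at this
    simp only [ha]
    linarith
  have hFy : ∀ i, l i = m * a i + ∑ j, A i j * inner ℝ (y i) (y j) := fun i => by
    have := congrArg (inner ℝ (y i)) (hF i)
    simp only [inner_add_right, inner_sum (𝕜 := ℝ) (f := fun j => A i j • y j),
      real_inner_smul_right, real_inner_self_eq_norm_sq, hy] at this
    rw [hsh, real_inner_smul_right] at this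
    simp only [ha]
    linarith
  set G := ∑ i, ∑ j, A i j * inner ℝ (y i) (y j) with hG
  have hcomm : ∑ i, ∑ j, A i j * a j = ∑ i, ∑ j, A i j * a i := by
    rw [Finset.sum_comm]
    exact Finset.sum_congr rfl fun i _ => Finset.sum_congr rfl fun j _ => by rw [hA_symm.apply]
  -- Expand the square: the constant term uses the first-order condition paired with `y i`, the
  -- other two use it paired with `h`.
  have hmain : ∑ i, l i * (1 - a i) ^ 2 = -2 * m * B + G +
      ∑ i, ∑ j, A i j * ((1 - a i) * (1 - a j)) - ∑ i, ∑ j, A i j := by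
    have h1 : ∀ i, l i * (1 - a i) ^ 2 = m * a i + ∑ j, A i j * inner ℝ (y i) (y j) -
        2 * (m + ∑ j, A i j * a j) + (m * a i + ∑ j, A i j * (a i * a j)) := fun i => by
      have h2 : ∑ j, A i j * (a i * a j) = a i * ∑ j, A i j * a j := by
        rw [Finset.mul_sum]; exact Finset.sum_congr rfl fun j _ => by ring
      rw [h2, ← hFy i, ← hFa i]
      linear_combination a i * hFa i
    have h3 : ∑ i, ∑ j, A i j * ((1 - a i) * (1 - a j)) = ∑ i, ∑ j, A i j -
        ∑ i, ∑ j, A i j * a i - ∑ i, ∑ j, A i j * a j + ∑ i, ∑ j, A i j * (a i * a j) := by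
      simp only [← Finset.sum_add_distrib, ← Finset.sum_sub_distrib]
      exact Finset.sum_congr rfl fun i _ => Finset.sum_congr rfl fun j _ => by ring
    rw [h3, Finset.sum_congr rfl fun i _ => h1 i]
    simp only [Finset.sum_add_distrib, Finset.sum_sub_distrib, ← Finset.mul_sum, hsa]
    rw [← hcomm, hBm]
    simp only [Finset.sum_const, Finset.card_univ, nsmul_eq_mul, ← hn]
    ring
  have hpos : 0 ≤ ∑ i, l i * (1 - a i) ^ 2 :=
    Finset.sum_nonneg fun i _ => mul_nonneg (hl i) (sq_nonneg _)
  have hyh : ∀ i, ‖y i - h‖ ^ 2 = 2 * (1 - a i) := fun i => by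
    rw [norm_sub_sq_real, hy, hh]; simp only [ha]; ring
  -- Recentring at `h` separates a quadratic form in `y i - h`, bounded by the operator norm, from a
  -- diagonal form weighted by the row sums, the only place where `hrow` enters.
  have hL : G - ∑ i, ∑ j, A i j ≤ (t * n + η * n) * (2 * B) := by
    have h1 : G - ∑ i, ∑ j, A i j = ∑ i, ∑ j, A i j * inner ℝ (y i - h) (y j - h) -
        ∑ i, (∑ j, A i j) * ‖y i - h‖ ^ 2 := by
      have h2 : ∀ i j, inner ℝ (y i - h) (y j - h) = inner ℝ (y i) (y j) - a i - a j + 1 := by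
        intro i j
        rw [inner_sub_left, inner_sub_right, inner_sub_right, real_inner_self_eq_norm_sq, hh,
          real_inner_comm (y j) h]
        simp only [ha]
        ring
      simp only [h2, hyh]
      have h3 : ∑ i, ∑ j, A i j * (inner ℝ (y i) (y j) - a i - a j + 1) = G -
          ∑ i, ∑ j, A i j * a i - ∑ i, ∑ j, A i j * a j + ∑ i, ∑ j, A i j := by
        simp only [hG, ← Finset.sum_add_distrib, ← Finset.sum_sub_distrib]
        exact Finset.sum_congr rfl fun i _ => Finset.sum_congr rfl fun j _ => by ring
      have h4 : ∑ i, (∑ j, A i j) * (2 * (1 - a i)) = 2 * ∑ i, ∑ j, A i j -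
          2 * ∑ i, ∑ j, A i j * a i := by
        simp only [Finset.mul_sum, Finset.sum_mul, ← Finset.sum_sub_distrib]
        exact Finset.sum_congr rfl fun i _ => Finset.sum_congr rfl fun j _ => by ring
      rw [h3, h4, hcomm]
      ring
    have h5 := (abs_le.1 (abs_quadForm_inner_le (mul_nonneg hη hn0.le) hA fun i => y i - h)).2
    have h6 : -∑ i, (∑ j, A i j) * ‖y i - h‖ ^ 2 ≤ t * n * ∑ i, ‖y i - h‖ ^ 2 := by
      rw [Finset.mul_sum, ← Finset.sum_neg_distrib]
      refine Finset.sum_le_sum fun i _ => ?_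
      nlinarith [mul_le_mul_of_nonneg_right (hrow i) (sq_nonneg ‖y i - h‖)]
    have h7 : ∑ i, ‖y i - h‖ ^ 2 = 2 * B := by simp only [hyh, ← Finset.mul_sum, hB]
    rw [h7] at h5 h6
    rw [h1]
    linarith
  have hq : ∑ i, ∑ j, A i j * ((1 - a i) * (1 - a j)) ≤ η * n * (2 * B) := by
    refine (abs_le.1 (abs_quadForm_le (mul_nonneg hη hn0.le) hA fun i => 1 - a i)).2.trans ?_
    refine mul_le_mul_of_nonneg_left ?_ (mul_nonneg hη hn0.le)
    rw [hB, Finset.mul_sum]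
    exact Finset.sum_le_sum fun i _ => by nlinarith [ha1 i]
  -- Since `m = n - B ≥ (1 - 8 η²) n`, the hypothesis `hηt` makes `-m + t n + 2 η n` negative.
  have hBzero : B = 0 := by
    by_contra hne
    have hBpos : 0 < B := lt_of_le_of_ne hB0 (Ne.symm hne)
    have h1 : 0 ≤ 2 * B * (-m + t * n + 2 * η * n) := by nlinarith
    have h2 : 0 ≤ -m + t * n + 2 * η * n := nonneg_of_mul_nonneg_right h1 (by linarith)
    nlinarith [mul_lt_mul_of_pos_right hηt hn0]
  have hyeq : ∀ i, y i = h := fun i => by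
    have h1 := (Finset.sum_eq_zero_iff_of_nonneg (s := Finset.univ) (f := fun i => 1 - a i)
      fun i _ => by linarith [(ha1 i).1]).1 hBzero i (Finset.mem_univ i)
    have h2 := hyh i
    rw [h1, mul_zero] at h2
    exact sub_eq_zero.1 (norm_eq_zero.1 (pow_eq_zero_iff two_ne_zero |>.1 h2))
  rw [hyeq i, hyeq j, real_inner_self_eq_norm_sq, hh, one_pow]

end Deterministic

/-! ### First- and second-order conditions in coordinates -/

section Critical

open Config

variable {n r : ℕ}

lemma hasGradientAt_syncObjective {C : Matrix (Fin n) (Fin n) ℝ} (hC : C.IsSymm)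
    (Y : Config n r) :
    HasGradientAt (syncObjective C r) (WithLp.toLp 2 fun i => (2 : ℝ) • ∑ j, C i j • Y j) Y := by
  rw [hasGradientAt_iff_hasFDerivAt]
  have h : HasFDerivAt (syncObjective C r) (∑ i, ∑ j, C i j •
      ((fderivInnerCLM ℝ (Y i, Y j)).comp
        ((PiLp.proj 2 (fun _ : Fin n => EuclideanSpace ℝ (Fin r)) i : Config n r →L[ℝ] _).prod
          (PiLp.proj 2 (fun _ : Fin n => EuclideanSpace ℝ (Fin r)) j : Config n r →L[ℝ] _)))) Y := by
    unfold syncObjective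
    refine HasFDerivAt.fun_sum fun i _ => HasFDerivAt.fun_sum fun j _ => ?_
    exact ((PiLp.hasFDerivAt_apply (𝕜 := ℝ) 2 Y i).inner ℝ
      (PiLp.hasFDerivAt_apply (𝕜 := ℝ) 2 Y j)).const_mul (C i j)
  refine h.congr_fderiv (ContinuousLinearMap.ext fun V => ?_)
  simp only [sum_apply, smul_apply,
    ContinuousLinearMap.comp_apply, ContinuousLinearMap.prod_apply, fderivInnerCLM_apply,
    PiLp.proj_apply, InnerProductSpace.toDual_apply_apply, smul_eq_mul, mul_add,
    Finset.sum_add_distrib]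
  rw [PiLp.inner_apply]
  have h1 : ∑ i, ∑ j, C i j * inner ℝ (Y i) (V j) = ∑ i, ∑ j, C i j * inner ℝ (V i) (Y j) := by
    rw [Finset.sum_comm]
    refine Finset.sum_congr rfl fun i _ => Finset.sum_congr rfl fun j _ => ?_
    rw [hC.apply, real_inner_comm]
  rw [h1, ← Finset.sum_add_distrib]
  refine Finset.sum_congr rfl fun i _ => ?_
  simp only [real_inner_smul_left, sum_inner]
  rw [← two_mul]
  congr 1
  exact Finset.sum_congr rfl fun j _ => by rw [real_inner_comm]

lemma riemGradient_syncObjective {C : Matrix (Fin n) (Fin n) ℝ} (hC : C.IsSymm) :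
    riemGradient (syncObjective C r) = fun Y => WithLp.toLp 2 fun i =>
      (2 : ℝ) • ∑ j, C i j • Y j - inner ℝ (Y i) ((2 : ℝ) • ∑ j, C i j • Y j) • Y i := by
  funext Y
  simp only [riemGradient, tangentProj, (hasGradientAt_syncObjective hC Y).gradient]

/-- Lets the outer projection in the Riemannian Hessian be dropped when it is paired with a tangent
vector. -/
lemma inner_tangentProj {Y U : Config n r} (hU : IsTangent Y U) (V : Config n r) :
    inner ℝ U (tangentProj Y V) = inner ℝ U V := by
  rw [PiLp.inner_apply, PiLp.inner_apply]
  refine Finset.sum_congr rfl fun i _ => ?_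
  change inner ℝ (U i) (V i - inner ℝ (Y i) (V i) • Y i) = inner ℝ (U i) (V i)
  rw [inner_sub_right, real_inner_smul_right, real_inner_comm (Y i) (U i), hU i, mul_zero, sub_zero]

lemma hasFDerivAt_sub_inner_smul {E F : Type*} [NormedAddCommGroup E] [NormedSpace ℝ E]
    [NormedAddCommGroup F] [InnerProductSpace ℝ F] (g p : E →L[ℝ] F) (Y : E) :
    HasFDerivAt (fun Z => g Z - inner ℝ (p Z) (g Z) • p Z)
      (g - (inner ℝ (p Y) (g Y) • p +
        ((fderivInnerCLM ℝ (p Y, g Y)).comp (p.prod g)).smulRight (p Y))) Y :=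
  g.hasFDerivAt.sub ((p.hasFDerivAt.inner ℝ g.hasFDerivAt).smul p.hasFDerivAt)

lemma apply_fderiv_of_eq_sub_inner_smul {E F G : Type*} [NormedAddCommGroup E] [NormedSpace ℝ E]
    [NormedAddCommGroup F] [InnerProductSpace ℝ F] [NormedAddCommGroup G] [NormedSpace ℝ G]
    (g p : E →L[ℝ] F) (q : G →L[ℝ] F) {f : E → G} {Y : E} (hf : DifferentiableAt ℝ f Y)
    (h : ∀ Z, q (f Z) = g Z - inner ℝ (p Z) (g Z) • p Z) (U : E) :
    q (fderiv ℝ f Y U) = g U - (inner ℝ (p Y) (g Y) • p U +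
      (inner ℝ (p Y) (g U) + inner ℝ (p U) (g Y)) • p Y) := by
  have h1 := q.hasFDerivAt.comp Y hf.hasFDerivAt
  rw [show q ∘ f = fun Z => g Z - inner ℝ (p Z) (g Z) • p Z from funext h] at h1
  have h2 := DFunLike.congr_fun (h1.unique (hasFDerivAt_sub_inner_smul g p Y)) U
  rw [ContinuousLinearMap.comp_apply] at h2
  rw [h2]
  rfl

lemma fderiv_riemGradient_syncObjective {C : Matrix (Fin n) (Fin n) ℝ} (hC : C.IsSymm)
    (Y U : Config n r) (i : Fin n) :
    fderiv ℝ (riemGradient (syncObjective C r)) Y U i =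
      (2 : ℝ) • ∑ j, C i j • U j - ((inner ℝ (Y i) ((2 : ℝ) • ∑ j, C i j • Y j)) • U i +
        (inner ℝ (Y i) ((2 : ℝ) • ∑ j, C i j • U j) +
          inner ℝ (U i) ((2 : ℝ) • ∑ j, C i j • Y j)) • Y i) := by
  obtain ⟨p, hp⟩ : ∃ p : Fin n → Config n r →L[ℝ] EuclideanSpace ℝ (Fin r),
      ∀ i Z, p i Z = Z i :=
    ⟨fun i => PiLp.proj 2 (fun _ : Fin n => EuclideanSpace ℝ (Fin r)) i, fun i Z => rfl⟩
  obtain ⟨g, hg⟩ : ∃ g : Fin n → Config n r →L[ℝ] EuclideanSpace ℝ (Fin r),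
      ∀ i Z, g i Z = (2 : ℝ) • ∑ j, C i j • Z j :=
    ⟨fun i => (2 : ℝ) • ∑ j, C i j • p j, fun i Z => by simp [hp]⟩
  have hF : ∀ i, (fun Z => riemGradient (syncObjective C r) Z i) =
      fun Z : Config n r => g i Z - inner ℝ (p i Z) (g i Z) • p i Z := fun i => by
    funext Z
    rw [riemGradient_syncObjective hC, hg, hp]
  have hD : DifferentiableAt ℝ (riemGradient (syncObjective C r)) Y :=
    (differentiableAt_piLp 2).2 fun i => by
      rw [hF i]; exact (hasFDerivAt_sub_inner_smul (g i) (p i) Y).differentiableAt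
  have h := apply_fderiv_of_eq_sub_inner_smul (g i) (p i) (p i) hD
    (fun Z => (hp i _).trans (congrFun (hF i) Z)) U
  simpa only [hp, hg] using h

/-- The first- and second-order conditions for `syncObjective` in coordinates. -/
lemma Config.IsSecondOrderCritical.exists_multipliers {C : Matrix (Fin n) (Fin n) ℝ}
    (hC : C.IsSymm) {Y : Config n r} (hY : IsSecondOrderCritical (syncObjective C r) Y) :
    ∃ l : Fin n → ℝ, (∀ i, ∑ j, C i j • Y j = l i • Y i) ∧
      ∀ u : Fin n → EuclideanSpace ℝ (Fin r), (∀ i, inner ℝ (Y i) (u i) = 0) →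
        ∑ i, ∑ j, C i j * inner ℝ (u i) (u j) ≤ ∑ i, l i * ‖u i‖ ^ 2 := by
  -- The factor 2 of the Euclidean gradient is divided out of the multipliers.
  refine ⟨fun i => inner ℝ (Y i) (∑ j, C i j • Y j), fun i => ?_, fun u hu => ?_⟩
  · have h := congrArg (fun Z : Config n r => Z i) hY.gradient_eq_zero
    rw [riemGradient_syncObjective hC] at h
    simp only [real_inner_smul_right, mul_smul, ← smul_sub, PiLp.zero_apply] at h
    exact sub_eq_zero.1 ((smul_eq_zero.1 h).resolve_left two_ne_zero)
  · have hU : IsTangent Y (WithLp.toLp 2 u) := hu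
    have h := hY.hessian_nonpos _ hU
    rw [riemHessian, inner_tangentProj hU, PiLp.inner_apply] at h
    simp only [fderiv_riemGradient_syncObjective hC, inner_sub_right, inner_add_right,
      real_inner_smul_right, inner_sum, real_inner_comm (Y _) (u _), hu,
      real_inner_self_eq_norm_sq, Finset.sum_sub_distrib, mul_zero, add_zero] at h
    have h2 : ∀ i, inner ℝ (Y i) (∑ j, C i j • Y j) * ‖u i‖ ^ 2 =
        (∑ j, C i j * inner ℝ (Y i) (Y j)) * ‖u i‖ ^ 2 := fun i => by
      simp only [inner_sum, real_inner_smul_right]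
    simp only [h2]
    simp only [mul_assoc, ← Finset.mul_sum] at h
    linarith

end Critical

/-! ### Operator norms from nets -/

section Net

variable {E : Type*}

/-- The closed ball of radius `2` has a `1`-net of cardinality at most `5 ^ dim`. -/
lemma exists_finset_net [NormedAddCommGroup E] [NormedSpace ℝ E] [FiniteDimensional ℝ E] :
    ∃ N : Finset E, N.card ≤ 5 ^ Module.finrank ℝ E ∧ (∀ p ∈ N, ‖p‖ ≤ 2) ∧
      ∀ x : E, ‖x‖ ≤ 2 → ∃ p ∈ N, ‖x - p‖ ≤ 1 := by
  classical
  -- A 1-separated subset of the ball of maximal cardinality is a 1-net.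
  let S : Set ℕ := {k | ∃ N : Finset E, N.card = k ∧ (∀ p ∈ N, ‖p‖ ≤ 2) ∧
    ∀ c ∈ N, ∀ d ∈ N, c ≠ d → 1 ≤ ‖c - d‖}
  have hbdd : BddAbove S := ⟨5 ^ Module.finrank ℝ E, by
    rintro k ⟨N, rfl, h1, h2⟩
    exact Besicovitch.card_le_of_separated N h1 h2⟩
  obtain ⟨N, hcard, h1, h2⟩ := Nat.sSup_mem (s := S) ⟨0, ∅, by simp⟩ hbdd
  refine ⟨N, Besicovitch.card_le_of_separated N h1 h2, h1, fun x hx => ?_⟩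
  by_contra! hfar
  have hxN : x ∉ N := fun h => by
    have := hfar x h
    rw [sub_self, norm_zero] at this
    linarith
  have hmem : N.card + 1 ∈ S := by
    refine ⟨insert x N, Finset.card_insert_of_notMem hxN, ?_, ?_⟩
    · simpa [hx] using h1
    · intro c hc d hd hcd
      rcases Finset.mem_insert.1 hc with hc | hc <;> rcases Finset.mem_insert.1 hd with hd | hd
      · exact absurd (hc.trans hd.symm) hcd
      · rw [hc]; exact (hfar d hd).le
      · rw [hd, norm_sub_rev]; exact (hfar c hc).le
      · exact h2 c hc d hd hcd
  have := le_csSup hbdd hmem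
  omega

/-- Approximate `2 v / ‖v‖`, whose pairing with `v` is `2 ‖v‖`: the error of the net costs at most
`‖v‖`. -/
lemma norm_le_of_net [NormedAddCommGroup E] [InnerProductSpace ℝ E] {N : Set E}
    (hN : ∀ x : E, ‖x‖ ≤ 2 → ∃ p ∈ N, ‖x - p‖ ≤ 1) {v : E} {M : ℝ} (hM : 0 ≤ M)
    (h : ∀ p ∈ N, inner ℝ p v ≤ M) : ‖v‖ ≤ M := by
  rcases eq_or_ne v 0 with rfl | hv
  · simpa using hM
  have hv0 : 0 < ‖v‖ := norm_pos_iff.2 hv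
  obtain ⟨p, hp, hxp⟩ := hN ((2 * ‖v‖⁻¹) • v) (by
    rw [norm_smul, norm_mul, norm_inv, norm_norm, mul_assoc, inv_mul_cancel₀ hv0.ne']
    norm_num)
  have h1 : inner ℝ ((2 * ‖v‖⁻¹) • v) v = 2 * ‖v‖ := by
    rw [real_inner_smul_left, real_inner_self_eq_norm_sq]
    field_simp
  have h2 := real_inner_le_norm ((2 * ‖v‖⁻¹) • v - p) v
  rw [inner_sub_left, h1] at h2
  have h3 := mul_le_mul_of_nonneg_right hxp hv0.le
  linarith [h p hp]

/-- The operator norm is controlled by the bilinear form on a net. -/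
lemma opNorm_le_of_net [NormedAddCommGroup E] [InnerProductSpace ℝ E] {N : Set E}
    (hN : ∀ x : E, ‖x‖ ≤ 2 → ∃ p ∈ N, ‖x - p‖ ≤ 1) (T : E →L[ℝ] E) {M : ℝ} (hM : 0 ≤ M)
    (h : ∀ p ∈ N, ∀ q ∈ N, inner ℝ p (T q) ≤ M) : ‖T‖ ≤ M := by
  have h1 : ∀ q ∈ N, ‖T q‖ ≤ M := fun q hq => norm_le_of_net hN hM fun p hp => h p hp q hq
  have h2 : ‖T‖ ≤ (M + ‖T‖) / 2 := by
    refine T.opNorm_le_of_unit_norm (by positivity) fun x hx => ?_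
    obtain ⟨p, hp, hxp⟩ := hN ((2 : ℝ) • x) (by rw [norm_smul, hx]; norm_num)
    have h3 : (2 : ℝ) • T x = T p + T ((2 : ℝ) • x - p) := by rw [map_sub, map_smul]; abel
    have h4 : 2 * ‖T x‖ ≤ M + ‖T‖ := by
      calc 2 * ‖T x‖ = ‖(2 : ℝ) • T x‖ := by rw [norm_smul]; norm_num
        _ ≤ ‖T p‖ + ‖T ((2 : ℝ) • x - p)‖ := by rw [h3]; exact norm_add_le _ _
        _ ≤ M + ‖T‖ * 1 := add_le_add (h1 p hp)
            ((T.le_opNorm _).trans (mul_le_mul_of_nonneg_left hxp (norm_nonneg _)))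
        _ = M + ‖T‖ := by rw [mul_one]
    linarith
  linarith

lemma sum_mulVec_sq_le_of_net {n : ℕ} {N : Set (EuclideanSpace ℝ (Fin n))}
    (hN : ∀ x, ‖x‖ ≤ 2 → ∃ p ∈ N, ‖x - p‖ ≤ 1) (A : Matrix (Fin n) (Fin n) ℝ) {M : ℝ}
    (hM : 0 ≤ M) (h : ∀ p ∈ N, ∀ q ∈ N, ∑ i, ∑ j, A i j * (p i * q j) ≤ M) (x : Fin n → ℝ) :
    ∑ i, (∑ j, A i j * x j) ^ 2 ≤ M ^ 2 * ∑ i, x i ^ 2 := by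
  let T : EuclideanSpace ℝ (Fin n) →L[ℝ] EuclideanSpace ℝ (Fin n) :=
    (Matrix.toEuclideanLin A).toContinuousLinearMap
  have hT : ∀ y i, T y i = ∑ j, A i j * y j := fun y i => by
    simp [T, Matrix.mulVec, dotProduct]
  have h1 : ‖T‖ ≤ M := opNorm_le_of_net hN T hM fun p hp q hq => by
    refine le_trans (le_of_eq ?_) (h p hp q hq)
    rw [PiLp.inner_apply]
    refine Finset.sum_congr rfl fun i _ => ?_
    rw [hT]
    simp only [RCLike.inner_apply, conj_trivial, Finset.sum_mul]
    exact Finset.sum_congr rfl fun j _ => by ring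
  have h2 := T.le_of_opNorm_le h1 (WithLp.toLp 2 x)
  have h3 := pow_le_pow_left₀ (norm_nonneg _) h2 2
  rw [mul_pow, EuclideanSpace.real_norm_sq_eq, EuclideanSpace.real_norm_sq_eq] at h3
  simpa only [hT] using h3

end Net

/-! ### Gaussian tails for the noise -/

/-- The matrix with its diagonal replaced by zero. -/
def Matrix.offDiagPart {n : ℕ} (A : Matrix (Fin n) (Fin n) ℝ) : Matrix (Fin n) (Fin n) ℝ :=
  Matrix.of fun i j => if i = j then 0 else A i j

section Noise

open MeasureTheory ProbabilityTheory

lemma sum_lt_pairs {n : ℕ} (F : Fin n → Fin n → ℝ) :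
    ∑ k : {k : Fin n × Fin n // k.1 < k.2}, F k.1.1 k.1.2 =
      ∑ i, ∑ j, if i < j then F i j else 0 := by
  rw [← Fintype.sum_prod_type' (f := fun i j => if i < j then F i j else 0), ← Finset.sum_filter]
  exact (Finset.sum_subtype _ (by simp) fun k : Fin n × Fin n => F k.1 k.2).symm

/-- Writes the bilinear form through the independent entries only; `sum_pairs_sq` then computes its
variance. -/
lemma sum_offDiagPart {n : ℕ} {A : Matrix (Fin n) (Fin n) ℝ} (hA : A.IsSymm) (p q : Fin n → ℝ) :
    ∑ i, ∑ j, A.offDiagPart i j * (p i * q j) =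
      ∑ k : {k : Fin n × Fin n // k.1 < k.2},
        (p k.1.1 * q k.1.2 + p k.1.2 * q k.1.1) * A k.1.1 k.1.2 := by
  rw [sum_lt_pairs fun i j => (p i * q j + p j * q i) * A i j]
  have h1 : ∑ i, ∑ j, A.offDiagPart i j * (p i * q j) =
      ∑ i, ∑ j, (if i < j then A i j * (p i * q j) else 0) +
        ∑ i, ∑ j, (if j < i then A i j * (p i * q j) else 0) := by
    simp only [← Finset.sum_add_distrib]
    refine Finset.sum_congr rfl fun i _ => Finset.sum_congr rfl fun j _ => ?_
    rcases lt_trichotomy i j with h | h | h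
    · simp [Matrix.offDiagPart, h, h.ne, h.not_gt]
    · simp [Matrix.offDiagPart, h]
    · simp [Matrix.offDiagPart, h, h.ne', h.not_gt]
  rw [h1, Finset.sum_comm (f := fun i j => if j < i then A i j * (p i * q j) else 0)]
  simp only [← Finset.sum_add_distrib]
  refine Finset.sum_congr rfl fun i _ => Finset.sum_congr rfl fun j _ => ?_
  split_ifs
  · rw [hA.apply]; ring
  · ring

lemma sum_pairs_sq {n : ℕ} (p q : Fin n → ℝ) :
    ∑ k : {k : Fin n × Fin n // k.1 < k.2}, (p k.1.1 * q k.1.2 + p k.1.2 * q k.1.1) ^ 2 =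
      (∑ i, p i ^ 2) * (∑ i, q i ^ 2) + (∑ i, p i * q i) ^ 2 - 2 * ∑ i, p i ^ 2 * q i ^ 2 := by
  rw [sum_lt_pairs fun i j => (p i * q j + p j * q i) ^ 2]
  set F : Fin n → Fin n → ℝ := fun i j => (p i * q j + p j * q i) ^ 2 with hF
  have h1 : ∑ i, ∑ j, F i j = 2 * (∑ i, ∑ j, if i < j then F i j else 0) + ∑ i, F i i := by
    have h2 : ∑ i, ∑ j, F i j = ∑ i, ∑ j, (if i < j then F i j else 0) +
        ∑ i, ∑ j, (if j < i then F i j else 0) + ∑ i, ∑ j, (if i = j then F i j else 0) := by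
      simp only [← Finset.sum_add_distrib]
      refine Finset.sum_congr rfl fun i _ => Finset.sum_congr rfl fun j _ => ?_
      rcases lt_trichotomy i j with h | h | h
      · simp [h, h.ne, h.not_gt]
      · simp [h]
      · simp [h, h.ne', h.not_gt]
    have h3 : ∑ i, ∑ j, (if j < i then F i j else 0) = ∑ i, ∑ j, if i < j then F i j else 0 := by
      rw [Finset.sum_comm]
      refine Finset.sum_congr rfl fun i _ => Finset.sum_congr rfl fun j _ => ?_
      simp only [hF, add_comm (p i * q j)]
    rw [h2, h3]
    simp only [Finset.sum_ite_eq, Finset.mem_univ, if_true]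
    ring
  have h4 : ∑ i, ∑ j, F i j =
      2 * ((∑ i, p i ^ 2) * ∑ i, q i ^ 2) + 2 * (∑ i, p i * q i) ^ 2 := by
    have h5 : ∑ i, ∑ j, F i j = ∑ i, ∑ j, p i ^ 2 * q j ^ 2 + ∑ i, ∑ j, q i ^ 2 * p j ^ 2 +
        2 * ∑ i, ∑ j, (p i * q i) * (p j * q j) := by
      simp only [Finset.mul_sum, ← Finset.sum_add_distrib]
      exact Finset.sum_congr rfl fun i _ => Finset.sum_congr rfl fun j _ => by
        simp only [hF]; ring
    rw [h5, ← Finset.sum_mul_sum, ← Finset.sum_mul_sum, ← Finset.sum_mul_sum]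
    ring
  have h6 : ∑ i, F i i = 4 * ∑ i, p i ^ 2 * q i ^ 2 := by
    rw [Finset.mul_sum]
    exact Finset.sum_congr rfl fun i _ => by simp only [hF]; ring
  linarith

variable {Ω : Type*} [MeasurableSpace Ω] {P : Measure Ω}

lemma hasSubgaussianMGF_of_hasLaw_gaussianReal {X : Ω → ℝ}
    (hX : HasLaw X (gaussianReal 0 1) P) : HasSubgaussianMGF X 1 P := by
  refine (HasSubgaussianMGF.id_map_iff hX.aemeasurable).1 ?_
  rw [hX.map_eq]
  refine ⟨fun t => integrable_exp_mul_gaussianReal t, fun t => ?_⟩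
  rw [mgf_id_gaussianReal]
  simp

/-- The Gaussian tail bound for the bilinear form of the off-diagonal part of the noise. -/
lemma IsGaussianNoise.measureReal_bilin_ge_le {n : ℕ} {W : Ω → Matrix (Fin n) (Fin n) ℝ}
    (hW : IsGaussianNoise P W) (p q : Fin n → ℝ) {v T : ℝ} (hv : 0 < v)
    (hpq : (∑ i, p i ^ 2) * (∑ i, q i ^ 2) + (∑ i, p i * q i) ^ 2 - 2 * ∑ i, p i ^ 2 * q i ^ 2 ≤ v)
    (hT : 0 ≤ T) :
    P.real {ω | T ≤ ∑ i, ∑ j, (W ω).offDiagPart i j * (p i * q j)} ≤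
      Real.exp (-T ^ 2 / (2 * v)) := by
  have hind : iIndepFun (fun (k : {k : Fin n × Fin n // k.1 < k.2}) ω =>
      (p k.1.1 * q k.1.2 + p k.1.2 * q k.1.1) * W ω k.1.1 k.1.2) P :=
    hW.indep.comp (fun k x => (p k.1.1 * q k.1.2 + p k.1.2 * q k.1.1) * x)
      fun k => measurable_const_mul _
  have h := HasSubgaussianMGF.sum_of_iIndepFun hind (s := Finset.univ) fun k _ =>
    (hasSubgaussianMGF_of_hasLaw_gaussianReal (hW.law k.1.1 k.1.2 k.2)).const_mul
      (p k.1.1 * q k.1.2 + p k.1.2 * q k.1.1)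
  have h' : HasSubgaussianMGF (fun ω => ∑ k : {k : Fin n × Fin n // k.1 < k.2},
      (p k.1.1 * q k.1.2 + p k.1.2 * q k.1.1) * W ω k.1.1 k.1.2) ⟨v, hv.le⟩ P := by
    refine ⟨h.integrable_exp_mul, fun t => (h.mgf_le t).trans (Real.exp_le_exp.2 ?_)⟩
    refine div_le_div_of_nonneg_right (mul_le_mul_of_nonneg_right ?_ (sq_nonneg t)) two_pos.le
    rw [NNReal.coe_sum]
    refine (Finset.sum_congr rfl fun k _ => ?_).trans_le ((sum_pairs_sq p q).trans_le hpq)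
    exact mul_one _
  simp only [sum_offDiagPart (hW.symm _)]
  exact h'.measure_ge_le hT

/-- With high probability, the off-diagonal noise has small operator norm and its signed row sums
are not too negative. -/
lemma IsGaussianNoise.measureReal_compl_good_le [IsProbabilityMeasure P] {n : ℕ} (hn : 0 < n)
    {W : Ω → Matrix (Fin n) (Fin n) ℝ} (hW : IsGaussianNoise P W) {z : Fin n → ℝ}
    (hz : ∀ i, z i = 1 ∨ z i = -1) {T : ℝ} (hT : 0 ≤ T) :
    P.real {ω | (∀ x : Fin n → ℝ, ∑ i, (∑ j, (W ω).offDiagPart i j * x j) ^ 2 ≤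
        (16 * √n) ^ 2 * ∑ i, x i ^ 2) ∧
      ∀ i, -T ≤ ∑ j, (W ω).offDiagPart i j * (z i * z j)}ᶜ ≤
    (25 * Real.exp (-4)) ^ n + n * Real.exp (-T ^ 2 / (2 * n)) := by
  classical
  have hn' : (0 : ℝ) < n := by exact_mod_cast hn
  have hz2 : ∀ i, z i ^ 2 = 1 := fun i => by rcases hz i with h | h <;> simp [h]
  obtain ⟨N, hcard, hN2, hN⟩ := exists_finset_net (E := EuclideanSpace ℝ (Fin n))
  rw [finrank_euclideanSpace_fin] at hcard
  have hsub : {ω | (∀ x : Fin n → ℝ, ∑ i, (∑ j, (W ω).offDiagPart i j * x j) ^ 2 ≤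
        (16 * √n) ^ 2 * ∑ i, x i ^ 2) ∧
      ∀ i, -T ≤ ∑ j, (W ω).offDiagPart i j * (z i * z j)}ᶜ ⊆
      (⋃ k ∈ N ×ˢ N, {ω | 16 * √n ≤ ∑ i, ∑ j, (W ω).offDiagPart i j * (k.1 i * k.2 j)}) ∪
      -- A negated signed row sum is the bilinear form at `(-z a e_a, z)`, so one tail bound serves
      -- both events; its variance is `n - 1`.
      ⋃ a ∈ (Finset.univ : Finset (Fin n)), {ω | T ≤ ∑ i, ∑ j, (W ω).offDiagPart i j *
        ((Pi.single a (-z a) : Fin n → ℝ) i * z j)} := by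
    intro ω hω
    by_contra hcon
    simp only [Set.mem_union, Set.mem_iUnion, Finset.mem_product, Finset.mem_univ,
      Set.mem_ofPred_eq, not_or, not_exists, not_le, exists_prop, not_and, true_and] at hcon
    refine hω ⟨?_, fun a => ?_⟩
    · exact sum_mulVec_sq_le_of_net (N := (N : Set (EuclideanSpace ℝ (Fin n)))) hN _
        (by positivity) fun p hp q hq => (hcon.1 (p, q) ⟨hp, hq⟩).le
    · have h := hcon.2 a
      rw [Fintype.sum_eq_single a fun k hk => by simp [hk]] at h
      simp only [Pi.single_eq_same, neg_mul, mul_neg, Finset.sum_neg_distrib] at h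
      linarith
  refine (measureReal_mono hsub).trans ((measureReal_union_le _ _).trans (add_le_add ?_ ?_))
  · refine (measureReal_biUnion_finset_le _ _).trans ?_
    have h1 : ∀ k ∈ N ×ˢ N, P.real {ω | 16 * √n ≤ ∑ i, ∑ j, (W ω).offDiagPart i j *
        (k.1 i * k.2 j)} ≤ Real.exp (-4) ^ n := by
      rintro ⟨p, q⟩ hk
      obtain ⟨hp, hq⟩ := Finset.mem_product.1 hk
      -- Net points have norm at most 2, so the variance is at most `16 + 16`. The tail `exp (-4 n)`
      -- then beats the `25 ^ n` pairs.
      refine (hW.measureReal_bilin_ge_le p q (v := 32) (by norm_num) ?_ (by positivity)).trans ?_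
      · have h2 := Finset.sum_mul_sq_le_sq_mul_sq Finset.univ (fun i => p i) fun i => q i
        have h3 : 0 ≤ ∑ i, p i ^ 2 * q i ^ 2 := Finset.sum_nonneg fun i _ => by positivity
        have h4 := pow_le_pow_left₀ (norm_nonneg _) (hN2 p hp) 2
        have h5 := pow_le_pow_left₀ (norm_nonneg _) (hN2 q hq) 2
        rw [EuclideanSpace.real_norm_sq_eq] at h4 h5
        have h6 := mul_le_mul h4 h5 (Finset.sum_nonneg fun i _ => sq_nonneg _) (by norm_num)
        linarith
      · rw [← Real.exp_nat_mul]
        refine Real.exp_le_exp.2 (le_of_eq ?_)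
        rw [mul_pow, Real.sq_sqrt hn'.le]
        ring
    refine (Finset.sum_le_card_nsmul _ _ _ h1).trans ?_
    rw [nsmul_eq_mul, mul_pow]
    refine mul_le_mul_of_nonneg_right ?_ (by positivity)
    have h7 : (N ×ˢ N).card ≤ 25 ^ n := by
      rw [Finset.card_product]
      refine (Nat.mul_le_mul hcard hcard).trans_eq ?_
      norm_num [← mul_pow]
    exact_mod_cast h7
  · refine (measureReal_biUnion_finset_le _ _).trans ?_
    refine (Finset.sum_le_card_nsmul _ _ (Real.exp (-T ^ 2 / (2 * n))) fun a _ => ?_).trans ?_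
    · refine hW.measureReal_bilin_ge_le _ z hn' ?_ hT
      rw [Fintype.sum_eq_single a fun k hk => by simp [hk],
        Fintype.sum_eq_single (f := fun i => (Pi.single a (-z a) : Fin n → ℝ) i * z i) a
          fun k hk => by simp [hk],
        Fintype.sum_eq_single (f := fun i => (Pi.single a (-z a) : Fin n → ℝ) i ^ 2 * z i ^ 2) a
          fun k hk => by simp [hk]]
      simp [hz2, mul_pow]
    · simp

end Noise

/-! ### Reduction to the all-ones signal and conclusion -/

open MeasureTheory Filter Topology

/-- Exact recovery at every second-order critical point, under deterministic conditions on
the noise. -/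
theorem toMatrix_mul_transpose_eq_of_noise_bounds {n r : ℕ} (hn : 0 < n) (hr : 2 ≤ r)
    {z : Fin n → ℝ} (hz : ∀ i, z i = 1 ∨ z i = -1) {W : Matrix (Fin n) (Fin n) ℝ}
    (hW : W.IsSymm) {σ η t K T : ℝ} (hσ : 0 ≤ σ) (hη : 0 ≤ η) (hη8 : η ≤ 1 / 8)
    (hηt : 8 * η ^ 2 + 2 * η < 1 - t) (hK : 0 ≤ K) (hσK : σ * K ≤ η * n) (hσT : σ * T ≤ t * n)
    (hop : ∀ x : Fin n → ℝ, ∑ i, (∑ j, W.offDiagPart i j * x j) ^ 2 ≤ K ^ 2 * ∑ i, x i ^ 2)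
    (hrow : ∀ i, -T ≤ ∑ j, W.offDiagPart i j * (z i * z j)) {Y : Config n r}
    (hY : Config.IsSecondOrderCritical (syncObjective (Matrix.vecMulVec z z + σ • W) r) Y) :
    Y.toMatrix * Y.toMatrix.transpose = Matrix.vecMulVec z z := by
  have hz2 : ∀ i, z i * z i = 1 := fun i => by rcases hz i with h | h <;> simp [h]
  have hsymm : (Matrix.vecMulVec z z + σ • W).IsSymm := by
    refine Matrix.IsSymm.ext fun i j => ?_
    simp only [Matrix.add_apply, Matrix.smul_apply, Matrix.vecMulVec_apply, hW.apply]
    ring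
  obtain ⟨l, hF, hH⟩ := hY.exists_multipliers hsymm
  have : Nonempty (Fin n) := ⟨⟨0, hn⟩⟩
  set W₀ := W.offDiagPart with hW₀
  have hW₀s : ∀ i j, W₀ i j = W₀ j i := fun i j => by
    simp only [hW₀, Matrix.offDiagPart, Matrix.of_apply, eq_comm, hW.apply]
  have hW₀d : ∀ i, W₀ i i = 0 := fun i => by simp [hW₀, Matrix.offDiagPart]
  -- the matrix of the problem, up to the diagonal and the change of signs
  have hC : ∀ i j, (Matrix.vecMulVec z z + σ • W) i j =
      z i * (z j * (1 + σ * (z i * z j * W₀ i j))) + if i = j then σ * W i i else 0 := by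
    intro i j
    by_cases h : i = j
    · subst h
      simp only [Matrix.add_apply, Matrix.smul_apply, Matrix.vecMulVec_apply, hW₀d, smul_eq_mul,
        if_true]
      ring
    · simp only [Matrix.add_apply, Matrix.smul_apply, Matrix.vecMulVec_apply, smul_eq_mul,
        if_neg h, hW₀, Matrix.offDiagPart, Matrix.of_apply]
      linear_combination -(σ * W i j) * hz2 i * (z j * z j) - σ * W i j * hz2 j
  let A : Matrix (Fin n) (Fin n) ℝ := Matrix.of fun i j => σ * (z i * z j * W₀ i j)
  have hA : ∀ i j, A i j = σ * (z i * z j * W₀ i j) := fun i j => rfl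
  -- The arbitrary diagonal of `W` only shifts the multipliers, because the rows have unit norm.
  have key := inner_eq_one_of_second_order (A := A) (y := fun i => z i • Y i)
    (l := fun i => l i - σ * W i i) (η := η) (t := t) hr ?_ ?_ ?_ ?_ ?_ hη hη8 hηt ?_ ?_
  · ext i j
    have h := key i j
    rw [real_inner_smul_left, real_inner_smul_right] at h
    have h1 : (Y.toMatrix * Y.toMatrix.transpose) i j = inner ℝ (Y i) (Y j) := by
      rw [PiLp.inner_apply, Matrix.mul_apply]
      exact Finset.sum_congr rfl fun k _ => by simp [Config.toMatrix, mul_comm]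
    rw [h1, Matrix.vecMulVec_apply]
    linear_combination z i * z j * h - (z j * z j * inner ℝ (Y i) (Y j)) * hz2 i -
      inner ℝ (Y i) (Y j) * hz2 j
  · exact Matrix.IsSymm.ext fun i j => by rw [hA, hA, hW₀s]; ring
  · intro i; rw [hA, hW₀d]; ring
  · intro i
    rw [norm_smul, hY.onSpheres i]
    rcases hz i with h | h <;> simp [h]
  · intro i
    have h1 : ∑ j, z j • Y j + ∑ j, A i j • z j • Y j =
        z i • (∑ j, (Matrix.vecMulVec z z + σ • W) i j • Y j - (σ * W i i) • Y i) := by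
      have h2 : (σ * W i i) • Y i = ∑ j, (if i = j then σ * W i i else 0) • Y j := by
        simp [ite_smul]
      rw [h2, ← Finset.sum_sub_distrib, ← Finset.sum_add_distrib, Finset.smul_sum]
      refine Finset.sum_congr rfl fun j _ => ?_
      rw [hC, add_smul, add_sub_cancel_right, smul_smul, smul_smul, ← add_smul, hA]
      congr 1
      linear_combination -(z j * (1 + σ * (z i * z j * W₀ i j))) * hz2 i
    rw [h1, hF i, ← sub_smul, smul_comm]
  · intro u hu
    have h1 := hH (fun i => z i • u i) fun i => by
      have := hu i
      rw [real_inner_smul_left] at this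
      rw [real_inner_smul_right]
      exact this
    have hnorm : ∀ i, ‖z i • u i‖ = ‖u i‖ := fun i => by
      rw [norm_smul]
      rcases hz i with h | h <;> simp [h]
    have h2 : ∑ i, ∑ j, (Matrix.vecMulVec z z + σ • W) i j * inner ℝ (z i • u i) (z j • u j) =
        ∑ i, ∑ j, (1 + A i j) * inner ℝ (u i) (u j) + ∑ i, σ * W i i * ‖u i‖ ^ 2 := by
      have h3 : ∀ i, σ * W i i * ‖u i‖ ^ 2 =
          ∑ j, (if i = j then σ * W i i else 0) * inner ℝ (z i • u i) (z j • u j) := fun i => by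
        rw [Fintype.sum_eq_single i fun j hj => by simp [hj.symm], if_pos rfl,
          real_inner_self_eq_norm_sq, hnorm]
      simp only [h3, ← Finset.sum_add_distrib]
      refine Finset.sum_congr rfl fun i _ => Finset.sum_congr rfl fun j _ => ?_
      rw [hC, add_mul, hA]
      congr 1
      rw [real_inner_smul_left, real_inner_smul_right]
      linear_combination (z j * z j * (1 + σ * (z i * z j * W₀ i j)) * inner ℝ (u i) (u j)) * hz2 i +
        ((1 + σ * (z i * z j * W₀ i j)) * inner ℝ (u i) (u j)) * hz2 j
    rw [h2] at h1
    simp only [hnorm] at h1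
    simp only [sub_mul, Finset.sum_sub_distrib]
    linarith
  · intro x
    have h1 := hop fun j => z j * x j
    have h2 : ∀ i, (∑ j, A i j * x j) ^ 2 = σ ^ 2 * (∑ j, W₀ i j * (z j * x j)) ^ 2 := fun i => by
      have : ∑ j, A i j * x j = σ * z i * ∑ j, W₀ i j * (z j * x j) := by
        rw [Finset.mul_sum]
        exact Finset.sum_congr rfl fun j _ => by rw [hA]; ring
      rw [this]
      linear_combination (σ ^ 2 * (∑ j, W₀ i j * (z j * x j)) ^ 2) * hz2 i
    have h3 : ∑ i, (z i * x i) ^ 2 = ∑ i, x i ^ 2 :=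
      Finset.sum_congr rfl fun i _ => by linear_combination x i ^ 2 * hz2 i
    rw [h3] at h1
    simp only [h2, ← Finset.mul_sum, Fintype.card_fin]
    calc σ ^ 2 * ∑ i, (∑ j, W₀ i j * (z j * x j)) ^ 2
        ≤ σ ^ 2 * (K ^ 2 * ∑ i, x i ^ 2) := mul_le_mul_of_nonneg_left h1 (sq_nonneg _)
      _ = (σ * K) ^ 2 * ∑ i, x i ^ 2 := by ring
      _ ≤ (η * n) ^ 2 * ∑ i, x i ^ 2 := mul_le_mul_of_nonneg_right
          (pow_le_pow_left₀ (mul_nonneg hσ hK) hσK 2) (Finset.sum_nonneg fun i _ => sq_nonneg _)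
  · intro i
    have h1 : ∑ j, A i j = σ * ∑ j, W₀ i j * (z i * z j) := by
      rw [Finset.mul_sum]
      exact Finset.sum_congr rfl fun j _ => by rw [hA]; ring
    rw [h1, Fintype.card_fin]
    have := mul_le_mul_of_nonneg_left (hrow i) hσ
    linarith

lemma tendsto_log_natCast_atTop : Tendsto (fun n : ℕ => Real.log n) atTop atTop :=
  Real.tendsto_log_atTop.comp tendsto_natCast_atTop_atTop

/-- The second term is `n ^ (1 - t² (1 + ε / 2))`, with a negative exponent by `ht`. -/
lemma tendsto_failure_bound {t ε : ℝ} (hε : 0 < ε) (ht : 1 < t ^ 2 * (1 + ε / 2)) :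
    Tendsto (fun n : ℕ => (25 * Real.exp (-4)) ^ n +
      n * Real.exp (-(t * √(n * ((2 + ε) * Real.log n))) ^ 2 / (2 * n))) atTop (𝓝 0) := by
  have h1 : Tendsto (fun n : ℕ => (25 * Real.exp (-4)) ^ n) atTop (𝓝 0) := by
    refine tendsto_pow_atTop_nhds_zero_of_lt_one (by positivity) ?_
    have h2 : (25 : ℝ) < Real.exp 4 := by
      have h3 : Real.exp 4 = Real.exp 1 ^ 4 := by rw [← Real.exp_nat_mul]; norm_num
      rw [h3]
      calc (25 : ℝ) < 2.7 ^ 4 := by norm_num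
        _ ≤ _ := pow_le_pow_left₀ (by norm_num) (by linarith [Real.exp_one_gt_d9]) 4
    rw [Real.exp_neg, ← div_eq_mul_inv]
    exact (div_lt_one (Real.exp_pos _)).2 h2
  have h4 : Tendsto (fun n : ℕ => Real.exp ((1 - t ^ 2 * (1 + ε / 2)) * Real.log n))
      atTop (𝓝 0) :=
    Real.tendsto_exp_atBot.comp
      (tendsto_log_natCast_atTop.const_mul_atTop_of_neg (by linarith))
  have h5 := h1.add h4
  rw [add_zero] at h5
  refine h5.congr' ?_
  filter_upwards [eventually_ge_atTop 1] with n hn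
  have hn0 : (0 : ℝ) < n := by exact_mod_cast hn
  have hlog : 0 ≤ Real.log n := Real.log_natCast_nonneg n
  congr 1
  have h6 : -(t * √(n * ((2 + ε) * Real.log n))) ^ 2 / (2 * n) =
      -(t ^ 2 * (1 + ε / 2) * Real.log n) := by
    rw [mul_pow, Real.sq_sqrt (by positivity)]
    field_simp
  rw [h6, sub_mul, one_mul, sub_eq_add_neg, Real.exp_add, Real.exp_log hn0]

theorem theorem3p1 (ε : ℝ) (hε : 0 < ε)
    (z : ∀ n : ℕ, Fin n → ℝ) (hz : ∀ n i, z n i = 1 ∨ z n i = -1)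
    (σ : ℕ → ℝ) (hσ_nonneg : ∀ n, 0 ≤ σ n)
    (hσ : ∀ᶠ n : ℕ in Filter.atTop, σ n ≤ Real.sqrt (n / ((2 + ε) * Real.log n)))
    {Ω : ℕ → Type*} [∀ n, MeasurableSpace (Ω n)]
    (P : ∀ n, MeasureTheory.Measure (Ω n)) [∀ n, MeasureTheory.IsProbabilityMeasure (P n)]
    (W : ∀ n, Ω n → Matrix (Fin n) (Fin n) ℝ) (hW : ∀ n, IsGaussianNoise (P n) (W n))
    (C : ∀ n, Ω n → Matrix (Fin n) (Fin n) ℝ)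
    (hC : ∀ n ω, C n ω = Matrix.vecMulVec (z n) (z n) + σ n • W n ω) :
    ∃ E : ∀ n, Set (Ω n),
      (∀ n, MeasurableSet (E n)) ∧
      Filter.Tendsto (fun n => P n (E n)) Filter.atTop (nhds 1) ∧
      ∀ n, ∀ ω ∈ E n, ∀ r : ℕ, 2 ≤ r → ∀ Y : Config n r,
        Config.IsSecondOrderCritical (syncObjective (C n ω) r) Y →
          Y.toMatrix * Y.toMatrix.transpose = Matrix.vecMulVec (z n) (z n) := by
  classical
  obtain ⟨t, ht0, ht1, ht⟩ : ∃ t : ℝ, 0 < t ∧ t < 1 ∧ 1 < t ^ 2 * (1 + ε / 2) := by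
    -- The second requirement amounts to `(1 + ε / 4)² > 1 + ε / 2`.
    refine ⟨(1 + ε / 4) / (1 + ε / 2), by positivity, ?_, ?_⟩
    · rw [div_lt_one (by positivity)]; linarith
    · rw [div_pow, div_mul_eq_mul_div, lt_div_iff₀ (by positivity)]
      nlinarith [mul_pos hε hε, mul_pos (mul_pos hε hε) hε]
  -- Then `8 η² + 2 η = (1 - t)² / 8 + (1 - t) / 4 < 1 - t`.
  set η : ℝ := (1 - t) / 8 with hη
  have hη0 : 0 < η := by rw [hη]; linarith
  -- Scaled so that the largest allowed `σ n` gives exactly `σ n * T n = t * n`.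
  let T : ℕ → ℝ := fun n => t * √(n * ((2 + ε) * Real.log n))
  let good : ∀ n, Set (Ω n) := fun n => {ω |
    (∀ x : Fin n → ℝ, ∑ i, (∑ j, (W n ω).offDiagPart i j * x j) ^ 2 ≤
      (16 * √n) ^ 2 * ∑ i, x i ^ 2) ∧
    ∀ i, -T n ≤ ∑ j, (W n ω).offDiagPart i j * (z n i * z n j)}
  let A : ℕ → Prop := fun n => 0 < n ∧ σ n * (16 * √n) ≤ η * n ∧ σ n * T n ≤ t * n
  have hAev : ∀ᶠ n in atTop, A n := by
    filter_upwards [hσ, eventually_ge_atTop 2,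
      tendsto_log_natCast_atTop.eventually_ge_atTop (256 / η ^ 2)] with n hσn hn2 hlogn
    have hn0 : (0 : ℝ) < n := by
      have : 0 < n := by omega
      exact_mod_cast this
    have hlog : 0 < Real.log n := lt_of_lt_of_le (by positivity) hlogn
    have hL : 0 < (2 + ε) * Real.log n := by positivity
    refine ⟨by omega, ?_, ?_⟩
    · refine abs_le_of_sq_le_sq' ?_ (by positivity) |>.2
      have h1 : σ n ^ 2 ≤ n / ((2 + ε) * Real.log n) := by
        rw [← Real.sq_sqrt (by positivity : (0 : ℝ) ≤ n / ((2 + ε) * Real.log n))]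
        exact pow_le_pow_left₀ (hσ_nonneg n) hσn 2
      have h2 : 256 ≤ η ^ 2 * ((2 + ε) * Real.log n) := by
        rw [div_le_iff₀ (by positivity)] at hlogn
        nlinarith [mul_pos hε hlog, sq_nonneg η, mul_nonneg (sq_nonneg η) (mul_pos hε hlog).le]
      rw [le_div_iff₀ hL] at h1
      have h3 : (σ n * (16 * √n)) ^ 2 = 256 * σ n ^ 2 * n := by
        rw [mul_pow, mul_pow, Real.sq_sqrt hn0.le]; ring
      rw [h3]
      calc 256 * σ n ^ 2 * n ≤ η ^ 2 * ((2 + ε) * Real.log n) * σ n ^ 2 * n := by gcongr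
        _ = η ^ 2 * (σ n ^ 2 * ((2 + ε) * Real.log n)) * n := by ring
        _ ≤ η ^ 2 * n * n := by gcongr
        _ = (η * n) ^ 2 := by ring
    · calc σ n * T n ≤ √(n / ((2 + ε) * Real.log n)) * T n := by gcongr
        _ = t * √(n / ((2 + ε) * Real.log n) * (n * ((2 + ε) * Real.log n))) := by
          rw [Real.sqrt_mul (by positivity)]; ring
        _ = t * √((n : ℝ) ^ 2) := by
          congr 2
          field_simp
        _ = t * n := by rw [Real.sqrt_sq hn0.le]
  -- Removing a measurable hull of the bad event gives a measurable subset of `good n` without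
  -- proving `good n` measurable. The empty set covers the `n` for which the bounds on `σ n` may
  -- fail.
  refine ⟨fun n => if A n then (toMeasurable (P n) (good n)ᶜ)ᶜ else ∅, fun n => ?_, ?_, ?_⟩
  · dsimp only
    split_ifs
    · exact (measurableSet_toMeasurable _ _).compl
    · exact MeasurableSet.empty
  · have h1 : Tendsto (fun n => (P n) (good n)ᶜ) atTop (𝓝 0) := by
      have h2 := ENNReal.tendsto_ofReal (tendsto_failure_bound hε ht)
      rw [ENNReal.ofReal_zero] at h2
      refine tendsto_of_tendsto_of_tendsto_of_le_of_le' tendsto_const_nhds h2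
        (Eventually.of_forall fun n => bot_le) ?_
      filter_upwards [eventually_gt_atTop 0] with n hn
      rw [← ofReal_measureReal]
      exact ENNReal.ofReal_le_ofReal
        ((hW n).measureReal_compl_good_le hn (hz n) (by positivity))
    have h3 := ENNReal.Tendsto.sub (tendsto_const_nhds (x := (1 : ENNReal))) h1
      (Or.inl ENNReal.one_ne_top)
    rw [tsub_zero] at h3
    refine h3.congr' ?_
    filter_upwards [hAev] with n hn
    rw [if_pos hn, prob_compl_eq_one_sub (measurableSet_toMeasurable _ _), measure_toMeasurable]
  · intro n ω hω r hr Y hY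
    dsimp only at hω
    split_ifs at hω with hA
    · have hgood : ω ∈ good n := by
        by_contra h
        exact hω (subset_toMeasurable _ _ h)
      rw [hC] at hY
      refine toMatrix_mul_transpose_eq_of_noise_bounds hA.1 hr (hz n) ((hW n).symm ω)
        (hσ_nonneg n) hη0.le ?_ ?_ (by positivity) hA.2.1 hA.2.2 hgood.1 hgood.2 hY
      · rw [hη]; linarith
      · rw [hη]; nlinarith
    · exact absurd hω (Set.notMem_empty ω)
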